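/- Let $K$ be a field, $n\ge 2$ and $t\ge 1$ integers, and $S=K[x_1,\ldots,x_n]$. For $1\le k\le n$ let $f_k=x_kx_{k+1}\cdots x_{k+n-3}$ be the product of the $n-2$ cyclically consecutive variables starting at $x_k$ (indices modulo $n$; $f_k=1$ if $n=2$), so that for $n\ge 3$ the ideal $(f_1,\ldots,f_n)$ is the $(n-2)$-path ideal of the $n$-cycle. Let $J_n=(f_1,f_3,f_4,\ldots,f_n)\subseteq S$ be the ideal generated by all $f_k$ with $k\ne 2$ (so $J_2=S$). For an $S$-module $M$ put $\beta_i(M)=\dim_K\operatorname{Tor}_i^S(K,M)$, where $K=S/(x_1,\ldots,x_n)$, and $\operatorname{pd}(M)=\sup\{i:\beta_i(M)\ne 0\}$. Then for all $i\ge 0$ $$\beta_i(J_n^t)=\binom{n-2}{i}\binom{n+t-i-2}{t-i},$$ where the right-hand side is read as $0$ if $i>t$ or $i>n-2$. In particular, $\operatorname{pd}(J_n^t)=\min(n-2,t)$. -/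

import Mathlib

open CategoryTheory

universe u

/-- The `S`-module `Tor_i^S(k, M)` for `S = K[x_1, …, x_n]`, where `k` is the field `K` viewed as
the `S`-module `S / (x_1, …, x_n)`. -/
noncomputable def torResidueField (K : Type u) [Field K] (n : ℕ) (M : Type u) [AddCommGroup M]
    [Module (MvPolynomial (Fin n) K) M] (i : ℕ) : ModuleCat.{u} (MvPolynomial (Fin n) K) :=
  ((Tor (ModuleCat.{u} (MvPolynomial (Fin n) K)) i).obj
    (ModuleCat.of (MvPolynomial (Fin n) K)
      (MvPolynomial (Fin n) K ⧸
        Ideal.span (Set.range (MvPolynomial.X : Fin n → MvPolynomial (Fin n) K))))).obj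
    (ModuleCat.of (MvPolynomial (Fin n) K) M)

/-- The `i`-th Betti number `β_i(M) = dim_K Tor_i^S(k, M)`, as a cardinal (so that it has no
default value), for a module `M` over `S = K[x_1, …, x_n]`. -/
noncomputable def bettiNumber (K : Type u) [Field K] (n : ℕ) (M : Type u) [AddCommGroup M]
    [Module (MvPolynomial (Fin n) K) M] (i : ℕ) : Cardinal.{u} :=
  Module.rank K
    ((ModuleCat.restrictScalars (algebraMap K (MvPolynomial (Fin n) K))).obj
      (torResidueField K n M i))

/-- The projective dimension `pd_S(M) = sup {i | β_i(M) ≠ 0}`; the supremum is taken in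
`ℕ ∪ {-∞, ∞}`, so it is `-∞` if all Betti numbers vanish. -/
noncomputable def bettiProjDim (K : Type u) [Field K] (n : ℕ) (M : Type u) [AddCommGroup M]
    [Module (MvPolynomial (Fin n) K) M] : WithBot ℕ∞ :=
  sSup ((fun i : ℕ => (i : WithBot ℕ∞)) '' {i : ℕ | bettiNumber K n M i ≠ 0})

/-- The monomial `x_k x_{k+1} ⋯ x_{k+m-1}` of the `m` consecutive vertices of the `n`-cycle that
start at `k`, with indices modulo `n`. The variables `x_1, …, x_n` are indexed by
`0, …, n - 1`. -/
noncomputable def cyclePathMonomial (K : Type u) [Field K] (n m : ℕ) (k : Fin n) :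
    MvPolynomial (Fin n) K :=
  ∏ j ∈ Finset.range m, MvPolynomial.X ⟨(k.val + j) % n, Nat.mod_lt _ k.pos⟩

/-- The ideal `J_n = (f_1, f_3, …, f_n)` of `K[x_1, …, x_n]`, where
`f_1 = x_1 ⋯ x_{n-2}, …, f_n = x_n x_1 ⋯ x_{n-3}` are the generators of the `(n-2)`-path ideal
of the `n`-cycle. The omitted `f_2` has index `1` when counting from `0`. For `n = 2` it is the
unit ideal. -/
noncomputable def truncatedCyclePathIdeal (K : Type u) [Field K] (n : ℕ) :
    Ideal (MvPolynomial (Fin n) K) :=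
  Ideal.span {f | ∃ k : Fin n, k.val ≠ 1 ∧ f = cyclePathMonomial K n (n - 2) k}

namespace CategoryTheory

open Limits

/-! Each `f_k` omits two cyclically adjacent variables, and `f_2` is the one omitting the last and
the first. The remaining generators thus correspond to the edges of a path, and `J_n` is the last of
a chain of ideals `I_0 = S`, `I_{q+1} = y I_q + (x g)`, where `x`, `y` are variables, `g ∈ I_q` and
`y` does not occur in the generators of `I_q` or in `x g` (`truncatedCyclePathIdeal_eq`).

For `I = I_q`, the power `(yI + (xg))^t` is the sum of the `y^e (xg)^(t-e) I^e` for `e ≤ t`. Its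
only syzygies are the obvious ones between neighbouring `e`, which gives an exact sequence `0 →
⊕_{e<t} I^e → ⊕_{e≤t} I^e → (yI + (xg))^t → 0` (`powSeq_exact`). The first map is `y` times the
inclusion minus `x` times a shift, so `Tor_i(k, -)` kills it (`tor_map_smul_eq_zero`). The long
exact sequence then breaks up (`exists_leftDerived_shortExact`), and the Betti numbers add:
`β_i(I_{q+1}^t) = ∑_{e≤t} β_i(I_q^e) + ∑_{e<t} β_{i-1}(I_q^e)`. The hockey-stick identity and
Pascal's rule solve this recursion. -/

lemma exact_congr {C : Type*} [Category* C] [HasZeroMorphisms C] {X Y Z : C} {f f' : X ⟶ Y}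
    {g g' : Y ⟶ Z} {w : f ≫ g = 0} {w' : f' ≫ g' = 0} (hf : f = f') (hg : g = g')
    (h : (ShortComplex.mk f' g' w').Exact) : (ShortComplex.mk f g w).Exact := by
  subst hf hg
  exact h

/-! ### Splicing short exact sequences into projective resolutions -/

section Splice

variable {C : Type*} [Category* C] [Abelian C]

/-- The chain complex obtained by splicing the sequences `Z (n + 1) ⟶ P n ⟶ Z n`. -/
noncomputable abbrev splicedComplex (P Z : ℕ → C) (p : ∀ n, P n ⟶ Z n) (i : ∀ n, Z (n + 1) ⟶ P n)
    (w : ∀ n, i n ≫ p n = 0) : ChainComplex C ℕ :=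
  ChainComplex.of P (fun n => p (n + 1) ≫ i n) (fun n => by
    rw [Category.assoc, reassoc_of% (w (n + 1)), zero_comp, comp_zero])

variable (P Z : ℕ → C) (p : ∀ n, P n ⟶ Z n) (i : ∀ n, Z (n + 1) ⟶ P n)
    (w : ∀ n, i n ≫ p n = 0)

lemma splicedComplex_d (n : ℕ) :
    (splicedComplex P Z p i w).d (n + 1) n = p (n + 1) ≫ i n :=
  ChainComplex.of_d P (fun n => p (n + 1) ≫ i n) n

/-- Precomposing with the epimorphism `p (n + 1)` does not change the image of `i n`. -/
lemma exact_splice (h : ∀ n, (ShortComplex.mk (i n) (p n) (w n)).ShortExact) (n : ℕ) :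
    (ShortComplex.mk (p (n + 1) ≫ i n) (p n)
      (by rw [Category.assoc, w n, comp_zero])).Exact := by
  have : Epi (p (n + 1)) := (h (n + 1)).epi_g
  let α : ShortComplex.mk (p (n + 1) ≫ i n) (p n)
      (by rw [Category.assoc, w n, comp_zero]) ⟶ ShortComplex.mk (i n) (p n) (w n) :=
    { τ₁ := p (n + 1)
      τ₂ := 𝟙 _
      τ₃ := 𝟙 _ }
  rw [ShortComplex.exact_iff_of_epi_of_isIso_of_mono α]
  exact (h n).exact

/-- Postcomposing with the monomorphism `i n` does not change the kernel of `p (n + 1)`. -/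
lemma exact_splice_splice (h : ∀ n, (ShortComplex.mk (i n) (p n) (w n)).ShortExact) (n : ℕ) :
    (ShortComplex.mk (p (n + 2) ≫ i (n + 1)) (p (n + 1) ≫ i n)
      (by rw [Category.assoc, reassoc_of% (w (n + 1)), zero_comp, comp_zero])).Exact := by
  have : Mono (i n) := (h n).mono_f
  let β : ShortComplex.mk (p (n + 2) ≫ i (n + 1)) (p (n + 1))
      (by rw [Category.assoc, w (n + 1), comp_zero]) ⟶
        ShortComplex.mk (p (n + 2) ≫ i (n + 1)) (p (n + 1) ≫ i n)
      (by rw [Category.assoc, reassoc_of% (w (n + 1)), zero_comp, comp_zero]) :=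
    { τ₁ := 𝟙 _
      τ₂ := 𝟙 _
      τ₃ := i n }
  rw [← ShortComplex.exact_iff_of_epi_of_isIso_of_mono β]
  exact exact_splice P Z p i w h (n + 1)

/-- The projective resolution given by a complex `K` of projectives which is exact in positive
degrees and an exact sequence `K.X 1 ⟶ K.X 0 ⟶ X ⟶ 0`. -/
noncomputable abbrev resolutionOfExact (K : ChainComplex C ℕ) (hK : ∀ n, Projective (K.X n)) {X : C}
    (ε : K.X 0 ⟶ X) (hε : Epi ε) (w : K.d 1 0 ≫ ε = 0) (h₀ : (ShortComplex.mk _ _ w).Exact)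
    (h : ∀ n, (ShortComplex.mk _ _ (K.d_comp_d (n + 2) (n + 1) n)).Exact) :
    ProjectiveResolution X where
  complex := K
  projective := hK
  π := (ChainComplex.toSingle₀Equiv _ _).symm ⟨ε, w⟩
  quasiIso := ⟨fun n => by
    cases n
    · rw [ChainComplex.quasiIsoAt₀_iff, ShortComplex.quasiIso_iff_of_zeros']
      · refine (ShortComplex.exact_and_epi_g_iff_of_iso ?_).2 ⟨h₀, hε⟩
        refine ShortComplex.isoMk (Iso.refl _) (Iso.refl _) (Iso.refl _) ?_ ?_ <;>
        · simp
          exact (Category.id_comp _).trans (Category.comp_id _).symm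
      all_goals first | rfl | exact K.shape _ _ (by simp)
    · rw [quasiIsoAt_iff_exactAt']
      · rw [HomologicalComplex.exactAt_iff' _ _ _ _ (ChainComplex.prev _ _)
          (ChainComplex.next_nat_succ _)]
        exact h _
      · apply ChainComplex.exactAt_succ_single_obj⟩

/-- The projective resolution obtained by splicing short exact sequences
`Z (n + 1) ⟶ P n ⟶ Z n` with `P n` projective. -/
noncomputable abbrev splicedResolution (hP : ∀ n, Projective (P n))
    (h : ∀ n, (ShortComplex.mk (i n) (p n) (w n)).ShortExact) :
    ProjectiveResolution (Z 0) :=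
  resolutionOfExact (splicedComplex P Z p i w) hP (p 0) (h 0).epi_g
    (by rw [splicedComplex_d, Category.assoc, w 0, comp_zero])
    (exact_congr (splicedComplex_d ..) rfl (exact_splice P Z p i w h 0))
    (fun n => exact_congr (splicedComplex_d ..) (splicedComplex_d ..)
      (exact_splice_splice P Z p i w h n))

lemma splicedResolution_π_f_zero (hP : ∀ n, Projective (P n))
    (h : ∀ n, (ShortComplex.mk (i n) (p n) (w n)).ShortExact) :
    (splicedResolution P Z p i w hP h).π.f 0 = p 0 :=
  ChainComplex.toSingle₀Equiv_symm_apply_f_zero _ _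

variable {P Z p i w} {P' Z' : ℕ → C} {p' : ∀ n, P' n ⟶ Z' n} {i' : ∀ n, Z' (n + 1) ⟶ P' n}
    {w' : ∀ n, i' n ≫ p' n = 0}

/-- The morphism of spliced complexes induced by a morphism of the given sequences. -/
noncomputable abbrev splicedComplexMap (a : ∀ n, P n ⟶ P' n) (b : ∀ n, Z n ⟶ Z' n)
    (hp : ∀ n, p n ≫ b n = a n ≫ p' n) (hi : ∀ n, i n ≫ a n = b (n + 1) ≫ i' n) :
    splicedComplex P Z p i w ⟶ splicedComplex P' Z' p' i' w' :=
  ChainComplex.ofHom a (fun n => by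
    rw [splicedComplex_d, splicedComplex_d, ← Category.assoc, ← hp, Category.assoc, Category.assoc,
      hi])

end Splice

/-! ### The horseshoe lemma -/

section Horseshoe

variable {C : Type*} [Category* C] [Abelian C]

/-- The kernels of a morphism of short exact sequences with epimorphic components form a short
exact sequence. -/
lemma shortExact_kernel {P S : ShortComplex C} (p : P ⟶ S) (hP : P.ShortExact)
    (hS : S.ShortExact) [Epi p.τ₁] : (kernel p).ShortExact := by
  let σ : ShortComplex.SnakeInput C :=
    { L₀ := kernel p
      L₁ := P
      L₂ := S
      L₃ := cokernel p
      v₀₁ := kernel.ι p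
      v₁₂ := p
      v₂₃ := cokernel.π p
      w₀₂ := kernel.condition p
      w₁₃ := cokernel.condition p
      h₀ := kernelIsKernel p
      h₃ := cokernelIsCokernel p
      L₁_exact := hP.exact
      epi_L₁_g := hP.epi_g
      L₂_exact := hS.exact
      mono_L₂_f := hS.mono_f }
  have : Mono σ.L₁.f := hP.mono_f
  have hf : Mono σ.L₀.f := σ.mono_L₀_f
  have : Epi σ.v₁₂.τ₁ := inferInstanceAs (Epi p.τ₁)
  have hz : σ.v₂₃.τ₁ = 0 := zero_of_epi_comp _ σ.w₁₃_τ₁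
  have : Epi σ.v₂₃.τ₁ := σ.epi_v₂₃_τ₁
  -- The cokernel of the epimorphism `p.τ₁` is the target of the connecting map, so its vanishing
  -- makes the map of kernels epi.
  have hz' : IsZero σ.L₃.X₁ := by
    rw [IsZero.iff_id_eq_zero, ← cancel_epi σ.v₂₃.τ₁, hz, zero_comp, zero_comp]
  have hg : Epi σ.L₀.g := (σ.L₁'.exact_iff_epi (hz'.eq_of_tgt _ _)).1 σ.L₁'_exact
  exact { exact := σ.L₀_exact, mono_f := hf, epi_g := hg }

variable [EnoughProjectives C]

/-- One step of the horseshoe lemma. -/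
lemma exists_projective_shortExact (S : ShortComplex C) (hS : S.ShortExact) :
    ∃ (P Z : ShortComplex C) (i : Z ⟶ P) (p : P ⟶ S) (w : i ≫ p = 0),
      P.ShortExact ∧ Z.ShortExact ∧
      Projective P.X₁ ∧ Projective P.X₂ ∧ Projective P.X₃ ∧
      (ShortComplex.mk i.τ₁ p.τ₁ (by rw [← ShortComplex.comp_τ₁, w]; rfl)).ShortExact ∧
      (ShortComplex.mk i.τ₂ p.τ₂ (by rw [← ShortComplex.comp_τ₂, w]; rfl)).ShortExact ∧
      (ShortComplex.mk i.τ₃ p.τ₃ (by rw [← ShortComplex.comp_τ₃, w]; rfl)).ShortExact := by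
  have := hS.epi_g
  have := hS.mono_f
  let P : ShortComplex C := ShortComplex.mk
    (biprod.inl : Projective.over S.X₁ ⟶ Projective.over S.X₁ ⊞ Projective.over S.X₃)
    biprod.snd (by simp)
  have hP : P.ShortExact := (ShortComplex.Splitting.ofHasBinaryBiproduct _ _).shortExact
  let p : P ⟶ S :=
    { τ₁ := Projective.π S.X₁
      τ₂ := biprod.desc (Projective.π S.X₁ ≫ S.f) (Projective.factorThru (Projective.π S.X₃) S.g)
      τ₃ := Projective.π S.X₃
      comm₁₂ := by simp [P]
      comm₂₃ := by
        dsimp only [P]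
        ext <;> simp }
  have h₁ : Epi p.τ₁ := by dsimp [p]; infer_instance
  have h₃ : Epi p.τ₃ := by dsimp [p]; infer_instance
  have h₂ : Epi p.τ₂ := ShortComplex.epi_τ₂_of_exact_of_epi p hS.exact
  refine ⟨P, kernel p, kernel.ι p, p, kernel.condition p, hP, shortExact_kernel p hP hS,
    by dsimp [P]; infer_instance, by dsimp [P]; infer_instance, by dsimp [P]; infer_instance,
    ?_, ?_, ?_⟩
  · have h := isLimitForkMapOfIsLimit' ShortComplex.π₁ (kernel.condition p) (kernelIsKernel p)
    exact { exact := ShortComplex.exact_of_f_is_kernel _ h, mono_f := mono_of_isLimit_fork h,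
            epi_g := h₁ }
  · have h := isLimitForkMapOfIsLimit' ShortComplex.π₂ (kernel.condition p) (kernelIsKernel p)
    exact { exact := ShortComplex.exact_of_f_is_kernel _ h, mono_f := mono_of_isLimit_fork h,
            epi_g := h₂ }
  · have h := isLimitForkMapOfIsLimit' ShortComplex.π₃ (kernel.condition p) (kernelIsKernel p)
    exact { exact := ShortComplex.exact_of_f_is_kernel _ h, mono_f := mono_of_isLimit_fork h,
            epi_g := h₃ }

/-- The horseshoe lemma. -/
theorem exists_horseshoe (S : ShortComplex C) (hS : S.ShortExact) :
    ∃ (P : ProjectiveResolution S.X₁) (Q : ProjectiveResolution S.X₂)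
      (R : ProjectiveResolution S.X₃) (f : P.complex ⟶ Q.complex) (g : Q.complex ⟶ R.complex)
      (w : ∀ n, f.f n ≫ g.f n = 0),
      (∀ n, (ShortComplex.mk (f.f n) (g.f n) (w n)).ShortExact) ∧
      f.f 0 ≫ Q.π.f 0 = P.π.f 0 ≫ S.f ∧ g.f 0 ≫ R.π.f 0 = Q.π.f 0 ≫ S.g := by
  choose P Z i p w hP hZ h₁ h₂ h₃ e₁ e₂ e₃ using
    exists_projective_shortExact (C := C)
  -- Iterated syzygy sequences: the kernel sequence of one step is the input of the next.
  let Y : ℕ → {S : ShortComplex C // S.ShortExact} :=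
    fun n => Nat.rec ⟨S, hS⟩ (fun _ T => ⟨Z T.1 T.2, hZ T.1 T.2⟩) n
  have w₁ (n) : (i (Y n).1 (Y n).2).τ₁ ≫ (p (Y n).1 (Y n).2).τ₁ = 0 := by
    rw [← ShortComplex.comp_τ₁, w]; rfl
  have w₂ (n) : (i (Y n).1 (Y n).2).τ₂ ≫ (p (Y n).1 (Y n).2).τ₂ = 0 := by
    rw [← ShortComplex.comp_τ₂, w]; rfl
  have w₃ (n) : (i (Y n).1 (Y n).2).τ₃ ≫ (p (Y n).1 (Y n).2).τ₃ = 0 := by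
    rw [← ShortComplex.comp_τ₃, w]; rfl
  let R₁ := splicedResolution (fun n => (P (Y n).1 (Y n).2).X₁) (fun n => (Y n).1.X₁)
    (fun n => (p (Y n).1 (Y n).2).τ₁) (fun n => (i (Y n).1 (Y n).2).τ₁) w₁
    (fun n => h₁ _ _) (fun n => e₁ _ _)
  let R₂ := splicedResolution (fun n => (P (Y n).1 (Y n).2).X₂) (fun n => (Y n).1.X₂)
    (fun n => (p (Y n).1 (Y n).2).τ₂) (fun n => (i (Y n).1 (Y n).2).τ₂) w₂
    (fun n => h₂ _ _) (fun n => e₂ _ _)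
  let R₃ := splicedResolution (fun n => (P (Y n).1 (Y n).2).X₃) (fun n => (Y n).1.X₃)
    (fun n => (p (Y n).1 (Y n).2).τ₃) (fun n => (i (Y n).1 (Y n).2).τ₃) w₃
    (fun n => h₃ _ _) (fun n => e₃ _ _)
  let f : R₁.complex ⟶ R₂.complex :=
    splicedComplexMap (w := w₁) (w' := w₂) (fun n => (P (Y n).1 (Y n).2).f) (fun n => (Y n).1.f)
      (fun n => (p (Y n).1 (Y n).2).comm₁₂) (fun n => (i (Y n).1 (Y n).2).comm₁₂)
  let g : R₂.complex ⟶ R₃.complex :=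
    splicedComplexMap (w := w₂) (w' := w₃) (fun n => (P (Y n).1 (Y n).2).g) (fun n => (Y n).1.g)
      (fun n => (p (Y n).1 (Y n).2).comm₂₃) (fun n => (i (Y n).1 (Y n).2).comm₂₃)
  have hε₁ : R₁.π.f 0 = (p (Y 0).1 (Y 0).2).τ₁ := splicedResolution_π_f_zero ..
  have hε₂ : R₂.π.f 0 = (p (Y 0).1 (Y 0).2).τ₂ := splicedResolution_π_f_zero ..
  have hε₃ : R₃.π.f 0 = (p (Y 0).1 (Y 0).2).τ₃ := splicedResolution_π_f_zero ..
  refine ⟨R₁, R₂, R₃, f, g, fun n => (P (Y n).1 (Y n).2).zero, fun n => hP _ _, ?_, ?_⟩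
  · rw [hε₁, hε₂]
    exact (p (Y 0).1 (Y 0).2).comm₁₂.symm
  · rw [hε₂, hε₃]
    exact (p (Y 0).1 (Y 0).2).comm₂₃.symm

end Horseshoe

/-! ### Long exact sequences of left derived functors -/

section LeftDerived

variable {C : Type*} [Category* C] [Abelian C] [EnoughProjectives C]
  {D : Type*} [Category* D] [Abelian D]

lemma homologyMap_zero_epi {K L : ChainComplex D ℕ} (g : K ⟶ L) [Epi g] :
    Epi (HomologicalComplex.homologyMap g 0) := by
  have h := ChainComplex.isoHomologyι₀_inv_naturality g
  rw [Iso.inv_comp_eq] at h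
  rw [h]
  infer_instance

/-- The objects enter only up to isomorphism with homology, because derived functors are identified
with the homology of the chosen resolutions by an isomorphism. -/
lemma exists_homology_shortExact {T : ShortComplex (ChainComplex D ℕ)} (hT : T.ShortExact)
    {X Y Z : ℕ → D} (x : ∀ n, X n ≅ T.X₁.homology n) (y : ∀ n, Y n ≅ T.X₂.homology n)
    (z : ∀ n, Z n ≅ T.X₃.homology n) (f : ∀ n, X n ⟶ Y n) (g : ∀ n, Y n ⟶ Z n)
    (hf : ∀ n, f n ≫ (y n).hom = (x n).hom ≫ HomologicalComplex.homologyMap T.f n)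
    (hg : ∀ n, g n ≫ (z n).hom = (y n).hom ≫ HomologicalComplex.homologyMap T.g n)
    (h : ∀ n, f n = 0) :
    IsIso (g 0) ∧ ∀ n, ∃ (δ : Z (n + 1) ⟶ X n) (w : g (n + 1) ≫ δ = 0),
      (ShortComplex.mk _ _ w).ShortExact := by
  have h0 (n) : HomologicalComplex.homologyMap T.f n = 0 := by
    have := hf n
    rw [h n, zero_comp] at this
    exact zero_of_epi_comp (x n).hom this.symm
  have hm (n) : Mono (HomologicalComplex.homologyMap T.g n) :=
    (ShortComplex.exact_iff_mono _ (h0 n)).1 (hT.homology_exact₂ n)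
  have eg (n) : g n = (y n).hom ≫ HomologicalComplex.homologyMap T.g n ≫ (z n).inv := by
    rw [← Category.assoc, Iso.eq_comp_inv, hg]
  refine ⟨?_, fun n => ?_⟩
  · have := hT.epi_g
    have := homologyMap_zero_epi T.g
    have := hm 0
    have : IsIso (HomologicalComplex.homologyMap T.g 0) := isIso_of_mono_of_epi _
    rw [eg]
    infer_instance
  · have hij : (ComplexShape.down ℕ).Rel (n + 1) n := by simp
    have hδ : Epi (hT.δ (n + 1) n hij) :=
      (ShortComplex.exact_iff_epi _ (h0 n)).1 (hT.homology_exact₁ (n + 1) n hij)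
    have w' : g (n + 1) ≫ (z (n + 1)).hom ≫ hT.δ (n + 1) n hij ≫ (x n).inv = 0 := by
      rw [eg, Category.assoc, Category.assoc, Iso.inv_hom_id_assoc,
        reassoc_of% (hT.comp_δ (n + 1) n hij), zero_comp, comp_zero]
    refine ⟨_, w', ?_⟩
    refine (ShortComplex.shortExact_iff_of_iso (ShortComplex.isoMk
      (S₁ := ShortComplex.mk _ _ w') (S₂ := ShortComplex.mk _ _ (hT.comp_δ (n + 1) n hij))
      (y (n + 1)) (z (n + 1)) (x n) ?_ ?_)).2 ?_
    · exact (hg (n + 1)).symm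
    · simp
    · exact { exact := hT.homology_exact₃ (n + 1) n hij, mono_f := hm _, epi_g := hδ }

/-- If the left derived functors of `F` kill the monomorphism of a short exact sequence, then the
long exact sequence splits into short exact sequences. -/
theorem exists_leftDerived_shortExact (F : C ⥤ D) [F.Additive] (S : ShortComplex C)
    (hS : S.ShortExact) (h : ∀ n, (F.leftDerived n).map S.f = 0) :
    IsIso ((F.leftDerived 0).map S.g) ∧
    ∀ n, ∃ (δ : (F.leftDerived (n + 1)).obj S.X₃ ⟶ (F.leftDerived n).obj S.X₁)
      (w : (F.leftDerived (n + 1)).map S.g ≫ δ = 0),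
      (ShortComplex.mk _ _ w).ShortExact := by
  obtain ⟨P, Q, R, f, g, w, hw, hf, hg⟩ := exists_horseshoe S hS
  let T : ShortComplex (ChainComplex D ℕ) :=
    ShortComplex.mk ((F.mapHomologicalComplex _).map f) ((F.mapHomologicalComplex _).map g) (by
      ext n
      change F.map (f.f n) ≫ F.map (g.f n) = 0
      rw [← F.map_comp, w, F.map_zero])
  have hT : T.ShortExact := by
    apply HomologicalComplex.shortExact_of_degreewise_shortExact
    intro n
    -- The rows split, so the merely additive functor `F` keeps them short exact.
    have : Projective (ShortComplex.mk (f.f n) (g.f n) (w n)).X₃ := R.projective n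
    exact ((hw n).splittingOfProjective.map F).shortExact
  exact exists_homology_shortExact hT (P.isoLeftDerivedObj F) (Q.isoLeftDerivedObj F)
    (R.isoLeftDerivedObj F) _ _ (P.isoLeftDerivedObj_hom_naturality S.f Q f hf F)
    (Q.isoLeftDerivedObj_hom_naturality S.g R g hg F) h

end LeftDerived

end CategoryTheory

/-! ### Vanishing and additivity of Tor -/

open Limits MonoidalCategory

lemma rank_eq_add_of_exact {K A B C : Type u} [Field K] [AddCommGroup A] [AddCommGroup B]
    [AddCommGroup C] [Module K A] [Module K B] [Module K C] (f : A →ₗ[K] B) (g : B →ₗ[K] C)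
    (hf : Function.Injective f) (hg : Function.Surjective g) (h : Function.Exact f g) :
    Module.rank K B = Module.rank K C + Module.rank K A := by
  rw [← LinearMap.rank_range_add_rank_ker g, LinearMap.exact_iff.1 h, LinearMap.range_eq_top.2 hg,
    rank_top, rank_range_of_injective _ hf]

lemma eq_zero_of_comp_iso_hom {C : Type*} [Category* C] [HasZeroMorphisms C] {X Y Z : C}
    (e : Y ≅ Z) (f : X ⟶ Y) (h : f ≫ e.hom = 0) : f = 0 :=
  zero_of_comp_mono e.hom h

/-- If a chain map lifts `φ`, then `r` times it lifts `r • φ`; after tensoring, `r` moves across to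
`X` and acts as zero. -/
lemma tor_map_smul_eq_zero {R : Type u} [CommRing R] (X : ModuleCat.{u} R) (r : R)
    (hr : ∀ x : X, r • x = 0) {M N : ModuleCat.{u} R} (φ : M ⟶ N) (i : ℕ) :
    ((Tor (ModuleCat.{u} R) i).obj X).map (r • φ) = 0 := by
  let P := ProjectiveResolution.of M
  let Q := ProjectiveResolution.of N
  have hw : (r • ProjectiveResolution.lift φ P Q).f 0 ≫ Q.π.f 0 = P.π.f 0 ≫ (r • φ) := by
    have h := ProjectiveResolution.lift_commutes_zero φ P Q
    exact (Linear.smul_comp _ _ _ r _ _).trans ((congrArg (r • ·) h).trans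
      (Linear.comp_smul _ _ _ _ r _).symm)
  have hz : (((tensoringLeft (ModuleCat.{u} R)).obj X).mapHomologicalComplex
      (ComplexShape.down ℕ)).map (r • ProjectiveResolution.lift φ P Q) = 0 := by
    ext n : 1
    change X ◁ (r • (ProjectiveResolution.lift φ P Q).f n) = 0
    apply ModuleCat.MonoidalCategory.tensor_ext
    intro (x : X) (y : P.complex.X n)
    change (x ⊗ₜ[R] (r • ((ProjectiveResolution.lift φ P Q).f n).hom y) :
      TensorProduct R X (Q.complex.X n)) = 0
    rw [← TensorProduct.smul_tmul, hr, TensorProduct.zero_tmul]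
  have h := P.isoLeftDerivedObj_hom_naturality (r • φ) Q _ hw
    ((tensoringLeft (ModuleCat.{u} R)).obj X) i
  rw [Functor.comp_map, hz, Functor.map_zero] at h
  exact eq_zero_of_comp_iso_hom (Q.isoLeftDerivedObj _ i) _ (h.trans comp_zero)

instance leftDerived_additive {C : Type*} [Category* C] [Abelian C] [HasProjectiveResolutions C]
    {D : Type*} [Category* D] [Abelian D] (F : C ⥤ D) [F.Additive] (n : ℕ) :
    (F.leftDerived n).Additive where
  map_add {X Y f g} := by
    let P := Classical.choice (HasProjectiveResolutions.out X).out
    let Q := Classical.choice (HasProjectiveResolutions.out Y).out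
    have hw : (ProjectiveResolution.lift f P Q + ProjectiveResolution.lift g P Q) ≫ Q.π =
        P.π ≫ (ChainComplex.single₀ _).map (f + g) := by
      rw [Preadditive.add_comp, ProjectiveResolution.lift_commutes,
        ProjectiveResolution.lift_commutes, Functor.map_add, Preadditive.comp_add]
    rw [F.leftDerived_map_eq n (f + g) _ hw,
      F.leftDerived_map_eq n f _ (ProjectiveResolution.lift_commutes f P Q),
      F.leftDerived_map_eq n g _ (ProjectiveResolution.lift_commutes g P Q),
      Functor.map_add, Preadditive.add_comp, Preadditive.comp_add]

lemma nonempty_leftDerived_zero_iso {C : Type*} [Category* C] [Abelian C]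
    [HasProjectiveResolutions C] {D : Type*} [Category* D] [Abelian D] (F : C ⥤ D) [F.Additive]
    (X : C) [Projective X] : Nonempty ((F.leftDerived 0).obj X ≅ F.obj X) :=
  ⟨asIso (F.fromLeftDerivedZero.app X)⟩

/-! ### Betti numbers of free modules, products and extensions -/

section Betti

variable {K : Type u} [Field K] {n : ℕ}

local notation "S" => MvPolynomial (Fin n) K

/-- `Tor_i(k, -)` as a functor to vector spaces. -/
noncomputable abbrev torFunctor (K : Type u) [Field K] (n : ℕ) (i : ℕ) :
    ModuleCat.{u} (MvPolynomial (Fin n) K) ⥤ ModuleCat.{u} K :=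
  ((Tor (ModuleCat.{u} (MvPolynomial (Fin n) K)) i).obj
    (ModuleCat.of (MvPolynomial (Fin n) K)
      (MvPolynomial (Fin n) K ⧸
        Ideal.span (Set.range (MvPolynomial.X : Fin n → MvPolynomial (Fin n) K))))) ⋙
    ModuleCat.restrictScalars (algebraMap K (MvPolynomial (Fin n) K))

instance (i : ℕ) : (torFunctor K n i).Additive := by
  have : ((Tor (ModuleCat.{u} (MvPolynomial (Fin n) K)) i).obj
    (ModuleCat.of (MvPolynomial (Fin n) K)
      (MvPolynomial (Fin n) K ⧸
        Ideal.span (Set.range (MvPolynomial.X : Fin n → MvPolynomial (Fin n) K))))).Additive :=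
    leftDerived_additive _ _
  infer_instance

lemma bettiNumber_congr {M N : Type u} [AddCommGroup M] [Module S M] [AddCommGroup N] [Module S N]
    (e : M ≃ₗ[S] N) (i : ℕ) : bettiNumber K n M i = bettiNumber K n N i :=
  LinearEquiv.rank_eq ((torFunctor K n i).mapIso e.toModuleIso).toLinearEquiv

lemma bettiNumber_pi {ι : Type} [Fintype ι] (M : ι → Type u) [∀ j, AddCommGroup (M j)]
    [∀ j, Module S (M j)] (i : ℕ) (b : ι → ℕ) (hb : ∀ j, bettiNumber K n (M j) i = b j) :
    bettiNumber K n (∀ j, M j) i = (∑ j, b j : ℕ) := by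
  let e₁ := ((torFunctor K n i).mapIso
    (ModuleCat.biproductIsoPi (fun j => ModuleCat.of S (M j)))).symm
  let e₂ := (torFunctor K n i).mapBiproduct (fun j => ModuleCat.of S (M j))
  let e₃ := ModuleCat.biproductIsoPi (fun j => (torFunctor K n i).obj (ModuleCat.of S (M j)))
  refine (LinearEquiv.rank_eq (e₁ ≪≫ e₂ ≪≫ e₃).toLinearEquiv).trans ?_
  refine rank_pi.trans ((congrArg Cardinal.sum (funext hb)).trans ?_)
  -- The indexed cardinal sum is evaluated as the size of a disjoint union of finite sets.
  have h := Cardinal.mk_sigma (fun j => ULift.{u} (Fin (b j)))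
  simpa using h.symm

lemma bettiNumber_self_succ (i : ℕ) : bettiNumber K n S (i + 1) = 0 := by
  have : Projective (ModuleCat.of S S) := inferInstance
  have h := isZero_Tor_succ_of_projective (ModuleCat.{u} S) (ModuleCat.of (MvPolynomial (Fin n) K)
      (MvPolynomial (Fin n) K ⧸
        Ideal.span (Set.range (MvPolynomial.X : Fin n → MvPolynomial (Fin n) K))))
        (ModuleCat.of S S) i
  have h' := ModuleCat.subsingleton_of_isZero
    ((ModuleCat.restrictScalars (algebraMap K S)).map_isZero h)
  exact @rank_subsingleton' _ _ _ _ _ _ h'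

lemma bettiNumber_self_zero : bettiNumber K n S 0 = 1 := by
  have : Projective (ModuleCat.of S S) := inferInstance
  let I : Ideal S := Ideal.span (Set.range (MvPolynomial.X : Fin n → MvPolynomial (Fin n) K))
  let X := ModuleCat.of S (S ⧸ I)
  obtain ⟨e⟩ := nonempty_leftDerived_zero_iso ((tensoringLeft (ModuleCat.{u} S)).obj X)
    (ModuleCat.of S S)
  have h := LinearEquiv.rank_eq ((ModuleCat.restrictScalars (algebraMap K S)).mapIso
    (e ≪≫ ρ_ X)).toLinearEquiv
  refine h.trans (rank_eq_one (M := (ModuleCat.restrictScalars (algebraMap K S)).obj X)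
    (Ideal.Quotient.mk I 1) ?_ ?_)
  · intro h1
    have h1 : (1 : S) ∈ I := Ideal.Quotient.eq_zero_iff_mem.1 h1
    have h2 : I ≤ RingHom.ker (MvPolynomial.constantCoeff : S →+* K) := by
      rw [Ideal.span_le]
      rintro _ ⟨j, rfl⟩
      simp
    simpa using h2 h1
  · intro w
    obtain ⟨f, rfl⟩ := Ideal.Quotient.mk_surjective (I := I) w
    refine ⟨MvPolynomial.constantCoeff f, ?_⟩
    change Ideal.Quotient.mk I (MvPolynomial.C (MvPolynomial.constantCoeff f) * 1) = _
    rw [mul_one, Ideal.Quotient.eq]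
    change _ ∈ MvPolynomial.idealOfVars _ _
    -- Membership in the first power is tested on coefficients of degree below 1, that is, on the
    -- constant term.
    rw [← pow_one (MvPolynomial.idealOfVars _ _), MvPolynomial.mem_pow_idealOfVars_iff']
    intro d hd
    have hd : d = 0 := by
      rw [← Finsupp.degree_eq_zero_iff]
      omega
    simp [hd, MvPolynomial.constantCoeff_eq]

/-- This is how a syzygy map killed by Tor turns an exact sequence into a recursion for Betti
numbers. -/
theorem bettiNumber_of_exact {A B C : Type u} [AddCommGroup A] [AddCommGroup B]
    [AddCommGroup C] [Module S A] [Module S B] [Module S C] (f : A →ₗ[S] B) (g : B →ₗ[S] C)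
    (hf : Function.Injective f) (hg : Function.Surjective g) (h : Function.Exact f g)
    (h0 : ∀ i, (torFunctor K n i).map (ModuleCat.ofHom f) = 0) :
    bettiNumber K n C 0 = bettiNumber K n B 0 ∧
    ∀ i, bettiNumber K n C (i + 1) = bettiNumber K n B (i + 1) + bettiNumber K n A i := by
  let X := (ModuleCat.of (MvPolynomial (Fin n) K)
      (MvPolynomial (Fin n) K ⧸
        Ideal.span (Set.range (MvPolynomial.X : Fin n → MvPolynomial (Fin n) K))))
  let T : ShortComplex (ModuleCat.{u} S) := ShortComplex.mk (ModuleCat.ofHom f)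
    (ModuleCat.ofHom g) (by ext x; exact h.apply_apply_eq_zero x)
  have hT : T.ShortExact := ModuleCat.shortComplex_shortExact T h hf hg
  have key := exists_leftDerived_shortExact ((tensoringLeft (ModuleCat.{u} S)).obj X) T hT
    (fun i => (ModuleCat.restrictScalars (algebraMap K S)).map_injective
      ((h0 i).trans ((ModuleCat.restrictScalars (algebraMap K S)).map_zero _ _).symm))
  refine ⟨?_, fun i => ?_⟩
  · have := key.1
    exact (LinearEquiv.rank_eq ((ModuleCat.restrictScalars (algebraMap K S)).mapIso
      (asIso ((((tensoringLeft (ModuleCat.{u} S)).obj X).leftDerived 0).map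
        T.g))).toLinearEquiv).symm
  · obtain ⟨δ, w, hδ⟩ := key.2 i
    exact (rank_eq_add_of_exact
      ((ModuleCat.restrictScalars (algebraMap K S)).map
        ((((tensoringLeft (ModuleCat.{u} S)).obj X).leftDerived (i + 1)).map T.g)).hom
      ((ModuleCat.restrictScalars (algebraMap K S)).map δ).hom
      hδ.moduleCat_injective_f hδ.moduleCat_surjective_g
      ((ShortComplex.ShortExact.moduleCat_exact_iff_function_exact _).1 hδ.exact)).trans
      (add_comm _ _)

end Betti

/-! ### The syzygies of powers of `yI + (p)` -/

section Syzygy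

variable {R : Type u} [CommRing R]

/-- The module of sequences `(a_e)` with `a_e ∈ I ^ e` for all `e` and `a_e = 0` for `e ≥ t`. -/
def powSeq (I : Ideal R) (t : ℕ) : Submodule R (ℕ → R) where
  carrier := {a | (∀ e, a e ∈ I ^ e) ∧ ∀ e, t ≤ e → a e = 0}
  add_mem' ha hb := ⟨fun e => add_mem (ha.1 e) (hb.1 e), fun e he => by
    simp [ha.2 e he, hb.2 e he]⟩
  zero_mem' := ⟨fun e => zero_mem _, fun _ _ => rfl⟩
  smul_mem' c a ha := ⟨fun e => Ideal.mul_mem_left _ c (ha.1 e), fun e he => by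
    simp [ha.2 e he]⟩

/-- `powSeq I t` is the product of the `I ^ e` for `e < t`. -/
def powSeqEquiv (I : Ideal R) (t : ℕ) : powSeq I t ≃ₗ[R] (∀ e : Fin t, ↥(I ^ (e : ℕ))) where
  toFun a e := ⟨a.1 e, a.2.1 e⟩
  map_add' _ _ := rfl
  map_smul' _ _ := rfl
  invFun b := ⟨fun e => if h : e < t then (b ⟨e, h⟩ : R) else 0, fun e => by
    dsimp only
    split_ifs with h
    · exact (b ⟨e, h⟩).2
    · exact zero_mem _, fun e he => dif_neg (by omega)⟩
  left_inv a := by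
    ext e
    by_cases h : e < t
    · simp [h]
    · simp [h, a.2.2 e (by omega)]
  right_inv b := by
    ext e
    simp

/-- The inclusion of `powSeq I t` into `powSeq I (t + 1)`. -/
def powSeqIncl (I : Ideal R) (t : ℕ) : powSeq I t →ₗ[R] powSeq I (t + 1) :=
  Submodule.inclusion fun _ ha => ⟨ha.1, fun e he => ha.2 e (by omega)⟩

/-- The map `(a_e) ↦ (g a_{e-1})` for `g ∈ I`. -/
def powSeqShift (I : Ideal R) {g : R} (hg : g ∈ I) (t : ℕ) :
    powSeq I t →ₗ[R] powSeq I (t + 1) where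
  toFun a := ⟨fun e => Nat.casesOn e 0 fun e => g * a.1 e, by
    refine ⟨fun e => ?_, fun e he => ?_⟩
    · cases e with
      | zero => exact zero_mem _
      | succ e =>
        rw [pow_succ']
        exact Ideal.mul_mem_mul hg (a.2.1 e)
    · cases e with
      | zero => rfl
      | succ e =>
        change g * a.1 e = 0
        rw [a.2.2 e (by omega), mul_zero]⟩
  map_add' a b := by
    ext e
    cases e with
    | zero => simp
    | succ e => exact mul_add _ _ _
  map_smul' c a := by
    ext e
    cases e with
    | zero => simp
    | succ e => exact mul_left_comm _ _ _

/-- The relations `(b_e) ↦ (y b_e - x g b_{e-1})`. -/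
def powSeqRel (I : Ideal R) {g : R} (hg : g ∈ I) (x y : R) (t : ℕ) :
    powSeq I t →ₗ[R] powSeq I (t + 1) :=
  y • powSeqIncl I t - x • powSeqShift I hg t

section

variable (I : Ideal R) {g : R} (hg : g ∈ I) (x y : R) (t : ℕ)

@[simp]
lemma powSeqRel_zero (b : powSeq I t) : (powSeqRel I hg x y t b).1 0 = y * b.1 0 := by
  change y * b.1 0 - x * 0 = _
  ring

@[simp]
lemma powSeqRel_succ (b : powSeq I t) (e : ℕ) :
    (powSeqRel I hg x y t b).1 (e + 1) = y * b.1 (e + 1) - x * g * b.1 e := by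
  change y * b.1 (e + 1) - x * (g * b.1 e) = _
  ring

lemma powSeqRel_injective [IsDomain R] (hy : y ≠ 0) :
    Function.Injective (powSeqRel I hg x y t) := by
  rw [injective_iff_map_eq_zero]
  intro b hb
  have h (e) : (powSeqRel I hg x y t b).1 e = 0 := by rw [hb]; rfl
  ext e
  change b.1 e = 0
  induction e with
  | zero => simpa [hy] using h 0
  | succ e ih => simpa [hy, ih] using h (e + 1)

end

lemma sum_mem_pow (I : Ideal R) (p y : R) (t : ℕ) (a : ℕ → R) (ha : ∀ e, a e ∈ I ^ e) :
    ∑ e ∈ Finset.range (t + 1), a e * y ^ e * p ^ (t - e) ∈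
      (Ideal.span {y} * I ⊔ Ideal.span {p}) ^ t := by
  refine sum_mem fun e he => ?_
  have het : e ≤ t := by simpa [Nat.lt_succ_iff] using he
  have hsplit := pow_add (Ideal.span {y} * I ⊔ Ideal.span {p}) e (t - e)
  rw [Nat.add_sub_cancel' het] at hsplit
  rw [hsplit]
  refine Ideal.mul_mem_mul ?_ ?_
  · have h : a e * y ^ e ∈ (Ideal.span {y} * I) ^ e := by
      rw [mul_pow, mul_comm (a e)]
      exact Ideal.mul_mem_mul (Ideal.pow_mem_pow (Ideal.mem_span_singleton_self y) e) (ha e)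
    exact Ideal.pow_right_mono le_sup_left e h
  · exact Ideal.pow_right_mono le_sup_right _
      (Ideal.pow_mem_pow (Ideal.mem_span_singleton_self p) _)

/-- The map `(a_e) ↦ ∑ a_e y^e p^(t-e)` onto the power of the ideal `yI + (p)`. -/
def powSeqEval (I : Ideal R) (p y : R) (t : ℕ) :
    powSeq I (t + 1) →ₗ[R] ↥((Ideal.span {y} * I ⊔ Ideal.span {p}) ^ t) where
  toFun a := ⟨∑ e ∈ Finset.range (t + 1), a.1 e * y ^ e * p ^ (t - e), sum_mem_pow I p y t a.1 a.2.1⟩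
  map_add' a b := by
    ext
    simp [add_mul, Finset.sum_add_distrib]
  map_smul' c a := by
    ext
    simp [Finset.mul_sum, mul_assoc]

lemma exists_powSeq_of_mem (I : Ideal R) (p y : R) (t : ℕ) (w : R)
    (hw : w ∈ (Ideal.span {y} * I ⊔ Ideal.span {p}) ^ t) :
    ∃ a ∈ powSeq I (t + 1), ∑ e ∈ Finset.range (t + 1), a e * y ^ e * p ^ (t - e) = w := by
  induction t generalizing w with
  | zero =>
    -- The zeroth power of the ideal is the whole ring, so `w` itself is the only entry.
    refine ⟨fun e => Nat.casesOn e w fun _ => 0, ⟨fun e => ?_, fun e he => ?_⟩, by simp⟩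
    · cases e <;> simp
    · cases e with
      | zero => omega
      | succ e => rfl
  | succ t ih =>
    rw [pow_succ'] at hw
    refine Submodule.mul_induction_on hw ?_ ?_
    · intro z hz w hw
      obtain ⟨a, ha, rfl⟩ := ih w hw
      obtain ⟨z₁, hz₁, z₂, hz₂, rfl⟩ := Submodule.mem_sup.1 hz
      obtain ⟨u, hu, rfl⟩ := Ideal.mem_span_singleton_mul.1 hz₁
      obtain ⟨c, rfl⟩ := Ideal.mem_span_singleton.1 hz₂
      -- Multiplying by `y u` raises the exponent of `y`, hence the shift; multiplying by `c p`
      -- keeps it, hence the inclusion.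
      refine ⟨powSeqShift I hu (t + 1) ⟨a, ha⟩ + c • powSeqIncl I (t + 1) ⟨a, ha⟩, by
        exact (powSeqShift I hu (t + 1) ⟨a, ha⟩ + c • powSeqIncl I (t + 1) ⟨a, ha⟩).2, ?_⟩
      have h₁ : ∑ e ∈ Finset.range (t + 2), (powSeqShift I hu (t + 1) ⟨a, ha⟩).1 e * y ^ e *
          p ^ (t + 1 - e) =
          y * u * ∑ e ∈ Finset.range (t + 1), a e * y ^ e * p ^ (t - e) := by
        rw [Finset.sum_range_succ', Finset.mul_sum]
        change _ + 0 * _ * _ = _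
        rw [zero_mul, zero_mul, add_zero]
        refine Finset.sum_congr rfl fun e he => ?_
        change u * a e * _ * _ = _
        rw [Nat.add_sub_add_right]
        ring
      have h₂ : ∑ e ∈ Finset.range (t + 2), (powSeqIncl I (t + 1) ⟨a, ha⟩).1 e * y ^ e *
          p ^ (t + 1 - e) =
          p * ∑ e ∈ Finset.range (t + 1), a e * y ^ e * p ^ (t - e) := by
        rw [Finset.sum_range_succ, Finset.mul_sum]
        change _ + a (t + 1) * _ * _ = _
        rw [ha.2 (t + 1) le_rfl, zero_mul, zero_mul, add_zero]
        refine Finset.sum_congr rfl fun e he => ?_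
        change a e * _ * _ = _
        rw [Nat.succ_sub (by simpa [Nat.lt_succ_iff] using he), pow_succ]
        ring
      calc _ = ∑ e ∈ Finset.range (t + 2), ((powSeqShift I hu (t + 1) ⟨a, ha⟩).1 e * y ^ e *
          p ^ (t + 1 - e) + c * ((powSeqIncl I (t + 1) ⟨a, ha⟩).1 e * y ^ e *
          p ^ (t + 1 - e))) := Finset.sum_congr rfl fun e _ => by
            change (_ + c * _) * _ * _ = _
            ring
        _ = _ := by
          rw [Finset.sum_add_distrib, ← Finset.mul_sum, h₁, h₂]
          ring
    · rintro _ _ ⟨a, ha, rfl⟩ ⟨b, hb, rfl⟩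
      exact ⟨a + b, add_mem ha hb, by simp [add_mul, Finset.sum_add_distrib]⟩

lemma powSeqEval_surjective (I : Ideal R) (p y : R) (t : ℕ) :
    Function.Surjective (powSeqEval I p y t) := by
  rintro ⟨w, hw⟩
  obtain ⟨a, ha, h⟩ := exists_powSeq_of_mem I p y t w hw
  exact ⟨⟨a, ha⟩, Subtype.ext h⟩

/-- Only the term `a 0 * p ^ t` lacks a visible factor `y`, so `y` divides `a 0`. Writing `a 0 = y
c`, one adds `p c` to `a 1`, cancels `y` and recurses. The recursion shifts indices, which is why a
general family `J` replaces the powers of `I`. -/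
lemma exists_syzygy [IsDomain R] {p y : R} (hy : y ≠ 0) (hp : ∀ k a, y ∣ a * p ^ k → y ∣ a)
    (t : ℕ) (J : ℕ → Ideal R) (hJ : ∀ e a, y * a ∈ J e → a ∈ J e)
    (hpJ : ∀ e, ∀ a ∈ J e, p * a ∈ J (e + 1)) (a : ℕ → R) (ha : ∀ e, a e ∈ J e)
    (h : ∑ e ∈ Finset.range (t + 1), a e * y ^ e * p ^ (t - e) = 0) :
    ∃ b : ℕ → R, (∀ e, b e ∈ J e) ∧ (∀ e, t ≤ e → b e = 0) ∧ a 0 = y * b 0 ∧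
      ∀ e < t, a (e + 1) = y * b (e + 1) - p * b e := by
  induction t generalizing J a with
  | zero =>
    refine ⟨0, fun _ => zero_mem _, fun _ _ => rfl, ?_, fun e he => absurd he (by omega)⟩
    simpa using h
  | succ t ih =>
    rw [Finset.sum_range_succ'] at h
    have hs : ∑ e ∈ Finset.range (t + 1), a (e + 1) * y ^ (e + 1) * p ^ (t + 1 - (e + 1)) =
        y * ∑ e ∈ Finset.range (t + 1), a (e + 1) * y ^ e * p ^ (t - e) := by
      rw [Finset.mul_sum]
      refine Finset.sum_congr rfl fun e _ => ?_
      rw [Nat.add_sub_add_right]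
      ring
    rw [hs] at h
    obtain ⟨c, hc⟩ : y ∣ a 0 := by
      refine hp (t + 1) _ ⟨-∑ e ∈ Finset.range (t + 1), a (e + 1) * y ^ e * p ^ (t - e), ?_⟩
      simp only [pow_zero, mul_one, Nat.sub_zero] at h
      linear_combination h
    have hcJ : c ∈ J 0 := hJ 0 c (hc ▸ ha 0)
    let a' : ℕ → R := fun e => a (e + 1) + if e = 0 then p * c else 0
    obtain ⟨b, hb, hbt, hb0, hb1⟩ := ih (fun e => J (e + 1)) (fun e => hJ (e + 1))
      (fun e => hpJ (e + 1)) a' (fun e => add_mem (ha _) (by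
        split_ifs with he
        · subst he
          exact hpJ 0 c hcJ
        · exact zero_mem _)) (by
        refine mul_left_cancel₀ hy ?_
        simp only [a', add_mul, Finset.sum_add_distrib, ite_mul, zero_mul, Finset.sum_ite_eq',
          Finset.mem_range, Nat.succ_pos, if_true]
        rw [hc, pow_zero, Nat.sub_zero] at h
        rw [pow_zero, Nat.sub_zero]
        linear_combination h)
    refine ⟨fun e => Nat.casesOn e c b, fun e => ?_, fun e he => ?_, hc, fun e he => ?_⟩
    · cases e with
      | zero => exact hcJ
      | succ e => exact hb e
    · cases e with
      | zero => omega
      | succ e => exact hbt e (by omega)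
    · cases e with
      | zero =>
        simp only [a', if_true] at hb0
        linear_combination hb0
      | succ e =>
        have := hb1 e (by omega)
        simp only [a', Nat.add_eq_zero_iff, one_ne_zero, and_false, if_false, add_zero] at this
        exact this

lemma powSeq_exact [IsDomain R] (I : Ideal R) {g : R} (hg : g ∈ I) (x y : R) (hy : y ≠ 0)
    (hp : ∀ k a, y ∣ a * (x * g) ^ k → y ∣ a) (hI : ∀ e a, y * a ∈ I ^ e → a ∈ I ^ e) (t : ℕ) :
    Function.Exact (powSeqRel I hg x y t) (powSeqEval I (x * g) y t) := by
  intro a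
  constructor
  · intro h
    obtain ⟨b, hb, hbt, hb0, hb1⟩ := exists_syzygy hy hp t (fun e => I ^ e) hI
      (fun e a ha => by
        rw [pow_succ', mul_assoc]
        exact Ideal.mul_mem_left _ _ (Ideal.mul_mem_mul hg ha)) a.1 a.2.1 (congrArg Subtype.val h)
    refine ⟨⟨b, hb, hbt⟩, ?_⟩
    ext e
    cases e with
    | zero => simp [hb0]
    | succ e =>
      rw [powSeqRel_succ]
      rcases lt_or_ge e t with he | he
      · exact (hb1 e he).symm
      · simp [hbt e he, hbt (e + 1) (by omega), a.2.2 (e + 1) (by omega)]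
  · rintro ⟨b, rfl⟩
    ext
    change ∑ e ∈ Finset.range (t + 1), _ * y ^ e * (x * g) ^ (t - e) = 0
    rw [Finset.sum_range_succ']
    simp only [powSeqRel_succ, powSeqRel_zero, sub_mul, Finset.sum_sub_distrib]
    -- The sum telescopes; the leftover top term vanishes because `b` is zero at `t`.
    have h := Finset.sum_range_succ' (fun e => y * b.1 e * y ^ e * (x * g) ^ (t - e)) t
    rw [Finset.sum_range_succ, b.2.2 t le_rfl] at h
    have h' : ∑ e ∈ Finset.range t, y * b.1 e * y ^ e * (x * g) ^ (t - e) =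
        ∑ e ∈ Finset.range t, x * g * b.1 e * y ^ (e + 1) * (x * g) ^ (t - (e + 1)) := by
      refine Finset.sum_congr rfl fun e he => ?_
      have : t - e = t - (e + 1) + 1 := by
        have := Finset.mem_range.1 he
        omega
      rw [this]
      ring
    rw [← h']
    linear_combination -h

end Syzygy

/-! ### The recursion for Betti numbers of powers -/

section Betti

variable {K : Type u} [Field K] {n : ℕ}

local notation "S" => MvPolynomial (Fin n) K

lemma torFunctor_map_smul {M N : Type u} [AddCommGroup M] [Module S M] [AddCommGroup N]
    [Module S N] (f : M →ₗ[S] N) (j : Fin n) (i : ℕ) :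
    (torFunctor K n i).map (ModuleCat.ofHom ((MvPolynomial.X j : S) • f)) = 0 := by
  have h := tor_map_smul_eq_zero (ModuleCat.of S
      (S ⧸ Ideal.span (Set.range (MvPolynomial.X : Fin n → MvPolynomial (Fin n) K))))
    (MvPolynomial.X j : S) (fun w => by
      obtain ⟨f, rfl⟩ := Ideal.Quotient.mk_surjective w
      exact Ideal.Quotient.eq_zero_iff_mem.2
        (Ideal.mul_mem_right _ _ (Ideal.subset_span ⟨j, rfl⟩))) (ModuleCat.ofHom f) i
  exact (congrArg (ModuleCat.restrictScalars (algebraMap K S)).map h).trans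
    ((ModuleCat.restrictScalars (algebraMap K S)).map_zero _ _)

/-- The Betti numbers of the powers of `yI + (xg)`, for `g ∈ I` and variables `x`, `y`. -/
theorem bettiNumber_sup_pow (I : Ideal S) {g : S} (hg : g ∈ I) (j k : Fin n)
    (hp : ∀ m (a : S), MvPolynomial.X k ∣ a * (MvPolynomial.X j * g) ^ m → MvPolynomial.X k ∣ a)
    (hI : ∀ e (a : S), MvPolynomial.X k * a ∈ I ^ e → a ∈ I ^ e)
    (b : ℕ → ℕ → ℕ) (hb : ∀ t i, bettiNumber K n ↥(I ^ t) i = b t i) (t : ℕ) :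
    bettiNumber K n ↥((Ideal.span {MvPolynomial.X k} * I ⊔
        Ideal.span {MvPolynomial.X j * g}) ^ t) 0 = (∑ e ∈ Finset.range (t + 1), b e 0 : ℕ) ∧
    ∀ i, bettiNumber K n ↥((Ideal.span {MvPolynomial.X k} * I ⊔
        Ideal.span {MvPolynomial.X j * g}) ^ t) (i + 1) =
      (∑ e ∈ Finset.range (t + 1), b e (i + 1) + ∑ e ∈ Finset.range t, b e i : ℕ) := by
  have hseq (t i) : bettiNumber K n (powSeq I t) i = (∑ e ∈ Finset.range t, b e i : ℕ) := by
    rw [bettiNumber_congr (powSeqEquiv I t), bettiNumber_pi (fun e : Fin t => ↥(I ^ (e : ℕ))) i (fun e => b e i)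
      (fun e => hb _ _), Fin.sum_univ_eq_sum_range (fun e => b e i)]
  have h0 (i) : (torFunctor K n i).map (ModuleCat.ofHom
      (powSeqRel I hg (MvPolynomial.X j) (MvPolynomial.X k) t)) = 0 := by
    have h₁ := torFunctor_map_smul (powSeqIncl I t) k i
    have h₂ := torFunctor_map_smul (powSeqShift I hg t) j i
    have h₃ : ModuleCat.ofHom (powSeqRel I hg (MvPolynomial.X j) (MvPolynomial.X k) t) =
      ModuleCat.ofHom ((MvPolynomial.X k : S) • powSeqIncl I t) -
        ModuleCat.ofHom ((MvPolynomial.X j : S) • powSeqShift I hg t) := rfl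
    rw [h₃, Functor.map_sub, h₁, h₂, sub_zero]
  obtain ⟨h₁, h₂⟩ := bettiNumber_of_exact _ _
    (powSeqRel_injective I hg (MvPolynomial.X j) (MvPolynomial.X k) t (MvPolynomial.X_ne_zero k))
    (powSeqEval_surjective I (MvPolynomial.X j * g) (MvPolynomial.X k) t)
    (powSeq_exact I hg (MvPolynomial.X j) (MvPolynomial.X k) (MvPolynomial.X_ne_zero k) hp hI t) h0
  refine ⟨h₁.trans (hseq _ _), fun i => ?_⟩
  rw [h₂, hseq, hseq, Nat.cast_add]

end Betti

/-! ### Ideals whose generators avoid a variable -/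

section VariableFree

open scoped Pointwise

variable {K : Type u} [Field K] {n : ℕ}

local notation "S" => MvPolynomial (Fin n) K

/-- Polynomials such that division by `X k` commutes with multiplication by them. -/
def divCommuting (K : Type u) [Field K] (k : Fin n) :
    Submonoid (MvPolynomial (Fin n) K) where
  carrier := {c | ∀ h : MvPolynomial (Fin n) K, MvPolynomial.divMonomial (c * h) (Finsupp.single k 1) =
    c * MvPolynomial.divMonomial h (Finsupp.single k 1)}
  one_mem' h := by rw [one_mul, one_mul]
  mul_mem' {a b} ha hb h := by rw [mul_assoc, ha, hb, mul_assoc]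

lemma X_mem_divCommuting {i k : Fin n} (h : i ≠ k) :
    (MvPolynomial.X i : S) ∈ divCommuting K k := by
  intro f
  ext m
  rw [MvPolynomial.coeff_divMonomial, MvPolynomial.coeff_X_mul', MvPolynomial.coeff_X_mul',
    MvPolynomial.coeff_divMonomial]
  have h1 : i ∈ (Finsupp.single k 1 + m).support ↔ i ∈ m.support := by
    simp [h]
  by_cases hi : i ∈ m.support
  · rw [if_pos (h1.2 hi), if_pos hi]
    congr 1
    ext l
    by_cases hl : l = i
    · subst hl
      simp [h]
    · simp [Finsupp.single_eq_of_ne hl]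
  · rw [if_neg (mt h1.1 hi), if_neg hi]

/-- Ideals generated by polynomials that commute with division by `X k`. -/
def IsVariableFree (k : Fin n) (I : Ideal S) : Prop :=
  ∃ G : Set S, G ⊆ divCommuting K k ∧ I = Ideal.span G

lemma IsVariableFree.mul {k : Fin n} {I J : Ideal S} (hI : IsVariableFree k I)
    (hJ : IsVariableFree k J) : IsVariableFree k (I * J) := by
  obtain ⟨G, hG, rfl⟩ := hI
  obtain ⟨H, hH, rfl⟩ := hJ
  refine ⟨G * H, ?_, Ideal.span_mul_span' G H⟩
  rintro _ ⟨a, ha, b, hb, rfl⟩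
  exact mul_mem (hG ha) (hH hb)

lemma IsVariableFree.sup {k : Fin n} {I J : Ideal S} (hI : IsVariableFree k I)
    (hJ : IsVariableFree k J) : IsVariableFree k (I ⊔ J) := by
  obtain ⟨G, hG, rfl⟩ := hI
  obtain ⟨H, hH, rfl⟩ := hJ
  exact ⟨G ∪ H, Set.union_subset hG hH, (Ideal.span_union G H).symm⟩

lemma isVariableFree_span_singleton {k : Fin n} {c : S} (hc : c ∈ divCommuting K k) :
    IsVariableFree k (Ideal.span {c}) :=
  ⟨{c}, Set.singleton_subset_iff.2 hc, rfl⟩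

lemma isVariableFree_top (k : Fin n) : IsVariableFree k (⊤ : Ideal S) := by
  rw [← Ideal.span_singleton_one]
  exact isVariableFree_span_singleton (one_mem _)

lemma IsVariableFree.pow {k : Fin n} {I : Ideal S} (hI : IsVariableFree k I) (e : ℕ) :
    IsVariableFree k (I ^ e) := by
  induction e with
  | zero => rw [pow_zero, Ideal.one_eq_top]; exact isVariableFree_top k
  | succ e ih => rw [pow_succ]; exact ih.mul hI

/-- Dividing by `X k` and discarding the remainder maps `I` into itself, and it sends `X k * a` to
`a`. -/
lemma IsVariableFree.mem_of_X_mul_mem {k : Fin n} {I : Ideal S} (hI : IsVariableFree k I) {a : S}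
    (ha : MvPolynomial.X k * a ∈ I) : a ∈ I := by
  obtain ⟨G, hG, rfl⟩ := hI
  -- This division is additive but not linear over the polynomial ring; the extra factor `h` absorbs
  -- scalars in the span induction.
  have h : ∀ f ∈ Ideal.span G, ∀ h : S,
      MvPolynomial.divMonomial (f * h) (Finsupp.single k 1) ∈ Ideal.span G := by
    intro f hf
    induction hf using Submodule.span_induction with
    | mem c hc =>
      intro h
      rw [hG hc h]
      exact Ideal.mul_mem_right _ _ (Ideal.subset_span hc)
    | zero => simp
    | add f g _ _ hf hg =>
      intro h
      rw [add_mul, MvPolynomial.add_divMonomial]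
      exact add_mem (hf h) (hg h)
    | smul c f _ hf =>
      intro h
      rw [smul_eq_mul, mul_comm c, mul_assoc]
      exact hf _
  have := h _ ha 1
  rwa [mul_one, MvPolynomial.X_mul_divMonomial] at this

end VariableFree

/-! ### The path ideal as the end of a recursive chain -/

section PathIdeal

variable {K : Type u} [Field K] {n : ℕ}

local notation "S" => MvPolynomial (Fin n) K

/-- The variables of `K[x_0, …, x_{n-1}]`, with indices modulo `n`. -/
noncomputable def cyclicVar (K : Type u) [Field K] (hn : 0 < n) (i : ℕ) : MvPolynomial (Fin n) K :=
  MvPolynomial.X ⟨i % n, Nat.mod_lt _ hn⟩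

/-- The ideal generated by the `x_0 ⋯ x_{q+1} / (x_j x_{j+1})` for `j ≤ q`, defined recursively. -/
noncomputable def edgeComplementIdeal (K : Type u) [Field K] (hn : 0 < n) :
    ℕ → Ideal (MvPolynomial (Fin n) K)
  | 0 => ⊤
  | q + 1 => Ideal.span {cyclicVar K hn (q + 2)} * edgeComplementIdeal K hn q ⊔
      Ideal.span {cyclicVar K hn q * ∏ i ∈ Finset.range q, cyclicVar K hn i}

/-- This is the element `g` of the recursion: the generator added at one step is the `g` of the
next. -/
lemma prod_range_mem_edgeComplementIdeal (hn : 0 < n) (q : ℕ) :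
    ∏ i ∈ Finset.range q, cyclicVar K hn i ∈ edgeComplementIdeal K hn q := by
  cases q with
  | zero => exact Submodule.mem_top
  | succ q =>
    rw [Finset.prod_range_succ, mul_comm]
    exact Ideal.mem_sup_right (Ideal.mem_span_singleton_self _)

lemma cyclicVar_index_ne (hn : 0 < n) {i k : ℕ} (hik : i < k) (hk : k < n) :
    (⟨i % n, Nat.mod_lt _ hn⟩ : Fin n) ≠ ⟨k % n, Nat.mod_lt _ hn⟩ := by
  rw [Ne, Fin.mk.injEq, Nat.mod_eq_of_lt hk, Nat.mod_eq_of_lt (hik.trans hk)]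
  exact hik.ne

lemma cyclicVar_mem_divCommuting (hn : 0 < n) {i k : ℕ} (hik : i < k) (hk : k < n) :
    cyclicVar K hn i ∈ divCommuting K ⟨k % n, Nat.mod_lt _ hn⟩ :=
  X_mem_divCommuting (cyclicVar_index_ne hn hik hk)

/-- Only the variables of index at most `q + 1` occur in the generators. -/
lemma isVariableFree_edgeComplementIdeal (hn : 0 < n) {q k : ℕ} (hq : q + 2 ≤ k) (hk : k < n) :
    IsVariableFree ⟨k % n, Nat.mod_lt _ hn⟩ (edgeComplementIdeal K hn q) := by
  induction q with
  | zero => exact isVariableFree_top _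
  | succ q ih =>
    refine ((isVariableFree_span_singleton (cyclicVar_mem_divCommuting hn (by omega) hk)).mul
      (ih (by omega))).sup (isVariableFree_span_singleton (mul_mem
        (cyclicVar_mem_divCommuting hn (by omega) hk) (prod_mem fun i hi => ?_)))
    have := Finset.mem_range.1 hi
    exact cyclicVar_mem_divCommuting hn (by omega) hk

lemma dvd_of_dvd_mul_pow (hn : 0 < n) {q : ℕ} (hq : q + 2 < n) (m : ℕ) (a : S)
    (h : cyclicVar K hn (q + 2) ∣
      a * (cyclicVar K hn q * ∏ i ∈ Finset.range q, cyclicVar K hn i) ^ m) :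
    cyclicVar K hn (q + 2) ∣ a := by
  have hp : Prime (cyclicVar K hn (q + 2)) := MvPolynomial.X_prime
  have hd (i : ℕ) (hi : i < q + 2) : ¬ cyclicVar K hn (q + 2) ∣ cyclicVar K hn i := by
    intro h
    exact cyclicVar_index_ne hn hi hq (MvPolynomial.X_dvd_X.1 h).symm
  refine (hp.dvd_or_dvd h).resolve_right fun h => ?_
  rcases hp.dvd_or_dvd (hp.dvd_of_dvd_pow h) with h | h
  · exact hd q (by omega) h
  · obtain ⟨i, hi, h⟩ := (hp.dvd_finsetProd_iff _).1 h
    have := Finset.mem_range.1 hi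
    exact hd i (by omega) h

lemma edgeComplementIdeal_eq_span (hn : 0 < n) (q : ℕ) :
    edgeComplementIdeal K hn q = Ideal.span ((fun j => (∏ i ∈ Finset.range j, cyclicVar K hn i) *
      ∏ i ∈ Finset.Ico (j + 2) (q + 2), cyclicVar K hn i) '' Set.Iic q) := by
  induction q with
  | zero =>
    have : (Set.Iic 0 : Set ℕ) = {0} := by ext; simp
    rw [this, Set.image_singleton]
    simp [edgeComplementIdeal]
  | succ q ih =>
    have h : (Set.Iic (q + 1) : Set ℕ) = Set.Iic q ∪ {q + 1} := by
      ext j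
      simp
      omega
    rw [h, Set.image_union, Ideal.span_union, edgeComplementIdeal, ih, Set.image_singleton,
      Ideal.span_mul_span', Set.singleton_mul, Set.image_image]
    congr 2
    · refine Set.image_congr fun j hj => ?_
      have := Set.mem_Iic.1 hj
      have hs := Finset.prod_Ico_succ_top (show j + 2 ≤ q + 2 by omega) (cyclicVar K hn)
      rw [hs]
      ring
    · rw [Finset.Ico_self, Finset.prod_empty, mul_one, Finset.prod_range_succ, mul_comm]

lemma cyclePathMonomial_zero (hn : 2 ≤ n) :
    cyclePathMonomial K n (n - 2) ⟨0, by omega⟩ =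
      (∏ i ∈ Finset.range (n - 2), cyclicVar K (by omega) i) *
      ∏ i ∈ Finset.Ico (n - 2 + 2) (n - 2 + 2), cyclicVar K (show 0 < n by omega) i := by
  simp [cyclePathMonomial, cyclicVar]

lemma cyclePathMonomial_add_two (hn : 2 ≤ n) (j : ℕ) (hj : j + 2 < n) :
    cyclePathMonomial K n (n - 2) ⟨j + 2, hj⟩ =
      (∏ i ∈ Finset.range j, cyclicVar K (by omega) i) *
      ∏ i ∈ Finset.Ico (j + 2) (n - 2 + 2), cyclicVar K (show 0 < n by omega) i := by
  -- The path from `j + 2` runs up to the last vertex and then wraps around to the first `j`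
  -- vertices.
  have h : n - 2 = (n - 2 + 2 - (j + 2)) + j := by omega
  have hc : cyclePathMonomial K n (n - 2) ⟨j + 2, hj⟩ =
    ∏ i ∈ Finset.range (n - 2), cyclicVar K (show 0 < n by omega) (j + 2 + i) := rfl
  rw [hc, Finset.prod_Ico_eq_prod_range, mul_comm]
  nth_rw 1 [h]
  rw [Finset.prod_range_add]
  congr 1
  refine Finset.prod_congr rfl fun i hi => ?_
  have : j + 2 + (n - 2 + 2 - (j + 2) + i) = i + n := by omega
  rw [this]
  simp [cyclicVar]

lemma truncatedCyclePathIdeal_eq (hn : 2 ≤ n) :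
    truncatedCyclePathIdeal K n = edgeComplementIdeal K (show 0 < n by omega) (n - 2) := by
  rw [edgeComplementIdeal_eq_span, truncatedCyclePathIdeal]
  congr 1
  ext f
  constructor
  · rintro ⟨⟨k, hk⟩, hk1, rfl⟩
    match k, hk, hk1 with
    | 0, hk, _ => exact ⟨n - 2, Set.mem_Iic.2 le_rfl, (cyclePathMonomial_zero hn).symm⟩
    | 1, _, hk1 => exact absurd rfl hk1
    | j + 2, hk, _ =>
      exact ⟨j, Set.mem_Iic.2 (by omega), (cyclePathMonomial_add_two hn j hk).symm⟩
  · rintro ⟨j, hj, rfl⟩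
    rcases (Set.mem_Iic.1 hj).eq_or_lt with rfl | hj
    · exact ⟨⟨0, by omega⟩, zero_ne_one, (cyclePathMonomial_zero hn).symm⟩
    · exact ⟨⟨j + 2, by omega⟩, by simp, (cyclePathMonomial_add_two hn j (by omega)).symm⟩

end PathIdeal

/-! ### Binomial identities solving the recursion -/

section Binomial

/-- The ranks `C(q, i) C(q + t - i, t - i)`, read as zero for `i > t`. -/
def edgeBetti (q t i : ℕ) : ℕ :=
  if i ≤ t then q.choose i * (q + t - i).choose (t - i) else 0

/-- Hockey-stick identity. The guard `i < T` is needed since the truncated `T - 1 - i` would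
otherwise give a spurious `choose _ 0 = 1`. -/
lemma sum_edgeBetti (q i T : ℕ) :
    ∑ e ∈ Finset.range T, edgeBetti q e i =
      if i < T then q.choose i * (q + T - i).choose (T - 1 - i) else 0 := by
  induction T with
  | zero => simp
  | succ T ih =>
    rw [Finset.sum_range_succ, ih, edgeBetti]
    rcases lt_trichotomy i T with h | rfl | h
    · obtain ⟨d, rfl⟩ := Nat.exists_eq_add_of_lt h
      rw [if_pos h, if_pos h.le, if_pos (by omega), ← mul_add]
      congr 1
      have e₁ : q + (i + d + 1) - i = q + d + 1 := by omega
      have e₂ : q + (i + d + 1 + 1) - i = q + d + 1 + 1 := by omega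
      have e₃ : i + d + 1 - 1 - i = d := by omega
      have e₄ : i + d + 1 - i = d + 1 := by omega
      have e₅ : i + d + 1 + 1 - 1 - i = d + 1 := by omega
      rw [e₁, e₂, e₃, e₄, e₅, Nat.choose_succ_succ (q + d + 1) d]
    · simp
    · rw [if_neg (by omega), if_neg (by omega), if_neg (by omega)]

lemma edgeBetti_succ_zero (q t : ℕ) :
    ∑ e ∈ Finset.range (t + 1), edgeBetti q e 0 = edgeBetti (q + 1) t 0 := by
  rw [sum_edgeBetti, edgeBetti]
  simp [add_assoc, add_comm 1 t]

/-- Both sums share the factor `(q + t - i).choose (t - 1 - i)`, so Pascal's rule for `(q +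
1).choose (i + 1)` finishes. -/
lemma edgeBetti_succ_succ (q t i : ℕ) :
    ∑ e ∈ Finset.range (t + 1), edgeBetti q e (i + 1) + ∑ e ∈ Finset.range t, edgeBetti q e i =
      edgeBetti (q + 1) t (i + 1) := by
  rw [sum_edgeBetti, sum_edgeBetti, edgeBetti]
  by_cases h : i < t
  · rw [if_pos (by omega), if_pos h, if_pos (by omega), Nat.choose_succ_succ]
    have e₁ : q + (t + 1) - (i + 1) = q + t - i := by omega
    have e₂ : q + 1 + t - (i + 1) = q + t - i := by omega
    have e₃ : t + 1 - 1 - (i + 1) = t - 1 - i := by omega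
    have e₄ : t - (i + 1) = t - 1 - i := by omega
    rw [e₁, e₂, e₃, e₄]
    ring
  · rw [if_neg (by omega), if_neg h, if_neg (by omega)]

lemma edgeBetti_ne_zero_iff (q t i : ℕ) : edgeBetti q t i ≠ 0 ↔ i ≤ min q t := by
  rw [edgeBetti, le_min_iff]
  by_cases h : i ≤ t
  · simp only [h, if_true, and_true, Ne, mul_eq_zero, Nat.choose_eq_zero_iff]
    omega
  · simp [h]

end Binomial

/-! ### The Betti numbers and the projective dimension -/

theorem bettiNumber_edgeComplementIdeal_pow {K : Type u} [Field K] {n : ℕ} (hn : 0 < n) (q : ℕ)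
    (hq : q + 2 ≤ n) (t i : ℕ) :
    bettiNumber K n ↥(edgeComplementIdeal K hn q ^ t) i = edgeBetti q t i := by
  -- The recursion involves all powers up to `t` and two homological degrees, so both stay general.
  induction q generalizing t i with
  | zero =>
    have e : ↥(edgeComplementIdeal K hn 0 ^ t) ≃ₗ[MvPolynomial (Fin n) K]
        MvPolynomial (Fin n) K :=
      (LinearEquiv.ofEq _ _ (by simp [edgeComplementIdeal, ← Ideal.one_eq_top])).trans
        Submodule.topEquiv
    rw [bettiNumber_congr e]
    cases i with
    | zero => simp [bettiNumber_self_zero, edgeBetti]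
    | succ i => simp [bettiNumber_self_succ, edgeBetti]
  | succ q ih =>
    have key := bettiNumber_sup_pow (edgeComplementIdeal K hn q)
      (prod_range_mem_edgeComplementIdeal hn q) ⟨q % n, Nat.mod_lt _ hn⟩
      ⟨(q + 2) % n, Nat.mod_lt _ hn⟩ (dvd_of_dvd_mul_pow hn (by omega))
      (fun e a => ((isVariableFree_edgeComplementIdeal hn le_rfl (by omega)).pow e).mem_of_X_mul_mem)
      (edgeBetti q) (ih (by omega)) t
    cases i with
    | zero => exact key.1.trans (by rw [edgeBetti_succ_zero])
    | succ i => exact (key.2 i).trans (by rw [edgeBetti_succ_succ])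

theorem corollary4 {K : Type u} [Field K] (n t : ℕ) (hn : 2 ≤ n) (ht : 1 ≤ t) :
    (∀ i : ℕ, bettiNumber K n ↥(truncatedCyclePathIdeal K n ^ t) i =
      ((if i ≤ t then (n - 2).choose i * (n + t - i - 2).choose (t - i) else 0 : ℕ) :
        Cardinal.{u})) ∧
    bettiProjDim K n ↥(truncatedCyclePathIdeal K n ^ t) = ((min (n - 2) t : ℕ) : WithBot ℕ∞) := by
  have h (i : ℕ) : bettiNumber K n ↥(truncatedCyclePathIdeal K n ^ t) i =
      edgeBetti (n - 2) t i := by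
    rw [truncatedCyclePathIdeal_eq hn]
    exact bettiNumber_edgeComplementIdeal_pow _ _ (by omega) t i
  refine ⟨fun i => ?_, ?_⟩
  · rw [h, edgeBetti]
    congr 1
    split_ifs with hi
    · congr 2
      omega
    · rfl
  · rw [bettiProjDim]
    refine IsGreatest.csSup_eq ⟨⟨min (n - 2) t, ?_, rfl⟩, ?_⟩
    · rw [Set.mem_ofPred_eq, h, Nat.cast_ne_zero, edgeBetti_ne_zero_iff]
    · rintro _ ⟨i, hi, rfl⟩
      rw [Set.mem_ofPred_eq, h, Nat.cast_ne_zero, edgeBetti_ne_zero_iff] at hi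
      change ((i : ℕ) : WithBot ℕ∞) ≤ _
      exact_mod_cast hi
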